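/- Let $G=(S,T;E)$ be a finite simple bipartite graph with colour classes $S$ and $T$ in which every node of $S$ has degree at most $4$ and every node of $T$ has degree at most $3$. An $S$-link is a path $P=(\{u,v,w\},\{uv,vw\})$ of length $2$ in $G$ whose two (distinct) end-nodes $u,w$ belong to $S$. Then $G$ has a matching $M\subseteq E$ and a family $\mathcal{F}$ of pairwise node-disjoint $S$-links such that every node $v\in T$ of degree $3$ is incident to an edge of $M\cup\bigcup_{P\in\mathcal{F}}E(P)$, where $E(P)$ is the edge set of $P$. (The matching $M$ and the links in $\mathcal{F}$ may share nodes.) -/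

import Mathlib

/-- For a bipartite graph `G` with colour class `S`, an `S`-link is a path
`P = ({u, v, w}, {uv, vw})` of length two in `G` with both end-nodes `u`, `w` in `S`. -/
def SimpleGraph.Subgraph.IsLink {V : Type*} {G : SimpleGraph V} (S : Set V)
    (P : G.Subgraph) : Prop :=
  ∃ u v w : V, u ∈ S ∧ w ∈ S ∧ u ≠ w ∧
    P.verts = {u, v, w} ∧ P.edgeSet = {s(u, v), s(v, w)}

/-!
Let the points be the nodes of `T` of degree at least `d` and let `N s` consist of the points
adjacent to `s`, so that each `N s` has at most `d + 1` points; the theorem is the case `d = 3`.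
Call `H` a trimming of `N` if it keeps at most two points of each `N s`, and two only when one of
them is also kept elsewhere. A trimming that covers all points is what is needed: one suitably
chosen point of each nonempty `H s` is matched to `s`, and every other point lies in two members of
`H`, which are the ends of a link.

Among the trimmings that cover as many points as possible take an inclusion-maximal one. Exchanging
a point of `H s` for an uncovered point of `N s` preserves optimality. Hence alternating walks of
exchanges from an uncovered point never reach a place with room for one more point: otherwise the
first exchange of a shortest such walk would yield an optimal trimming with a shorter one.

If some point is uncovered, let `R` be the set of covered points from which no such walk starts and
`Q` the set of `s` such that `N s` contains a point of `R` or an uncovered point. The pairs `s ∈ Q`,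
`t ∈ R` with `t` in `N s` but not in `H s` are counted in two ways. As each `t` lies in at least `d`
of the sets `N s`, a point of `R` in `k` members of `H` gives at least `d - k` pairs. The points
that can be exchanged in the various `H s`, `s ∈ Q`, are distinct and lie in `R`; at each `s ∈ Q`
one of them has `k = 1` or two of them have `k = 2`, so there are at least `(d - 1) |Q|` pairs when
`3 ≤ d`. But each `s ∈ Q` is in at most `d - 1` pairs, because `H s` either contains two of the at
most `d + 1` points of `N s` or, by maximality, contains all covered ones, and in strictly fewer
than `d - 1` if `N s` has an uncovered point.
-/

open Finset Function

section Exchange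

variable {α β : Type*} [DecidableEq α] [DecidableEq β] {H : α → Finset β} {s s₀ : α} {x y z : β}

theorem mem_update_insert_erase {s' : α} (t : β) (hy : y ∈ H s') (h : s' ≠ s ∨ y ≠ x) :
    y ∈ Function.update H s (insert t ((H s).erase x)) s' := by
  rcases eq_or_ne s' s with rfl | hne
  · simp_all
  · simpa [hne] using hy

/-- The family obtained from `H` by deleting `x` everywhere and adding `z` at `s₀`, one step of an
alternating walk. -/
def exchangeFamily (H : α → Finset β) (s₀ : α) (x z : β) (s : α) : Finset β :=
  if s = s₀ then insert z ((H s).erase x) else (H s).erase x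

theorem mem_exchangeFamily :
    y ∈ exchangeFamily H s₀ x z s ↔ y ∈ H s ∧ y ≠ x ∨ y = z ∧ s = s₀ := by
  grind [exchangeFamily]

theorem exchangeFamily_self : exchangeFamily H s₀ x z s₀ = insert z ((H s₀).erase x) := if_pos rfl

theorem exchangeFamily_of_ne (hs : s ≠ s₀) : exchangeFamily H s₀ x z s = (H s).erase x := if_neg hs

theorem card_exchangeFamily_le (hx : x ∈ H s₀) (s : α) : #(exchangeFamily H s₀ x z s) ≤ #(H s) := by
  rcases eq_or_ne s s₀ with rfl | hs
  · rw [exchangeFamily_self, ← card_erase_add_one hx]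
    exact card_insert_le _ _
  · rw [exchangeFamily_of_ne hs]
    exact card_erase_le

theorem exchangeFamily_eq_of_card_eq_two (hs : s ≠ s₀) (hcard : #(H s) ≤ 2)
    (h : #(exchangeFamily H s₀ x z s) = 2) : exchangeFamily H s₀ x z s = H s :=
  eq_of_subset_of_card_le ((exchangeFamily_of_ne hs).trans_subset (erase_subset x _)) (h ▸ hcard)

end Exchange

section Trimming

variable {α β : Type*} [Fintype α] [DecidableEq β] {N H K : α → Finset β} {s s₀ : α} {t x z : β}
  {d : ℕ}

/-- The number of members of the family `H` that contain `t`. -/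
def familyDegree (H : α → Finset β) (t : β) : ℕ := #{s | t ∈ H s}

/-- The points that lie in some member of the family `H`. -/
def coveredPoints (H : α → Finset β) : Finset β := univ.biUnion H

theorem mem_coveredPoints : t ∈ coveredPoints H ↔ ∃ s, t ∈ H s := by
  simp [coveredPoints]

theorem mem_coveredPoints_of_mem (h : t ∈ H s) : t ∈ coveredPoints H :=
  mem_coveredPoints.2 ⟨s, h⟩

theorem ne_of_notMem_coveredPoints {y : β} (hz : z ∉ coveredPoints H) (hy : y ∈ H s) : y ≠ z :=
  ne_of_mem_of_not_mem (mem_coveredPoints_of_mem hy) hz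

theorem familyDegree_eq_one_iff (hs : t ∈ H s) :
    familyDegree H t = 1 ↔ ∀ s', t ∈ H s' → s' = s := by
  refine card_eq_one.trans ⟨?_, fun h => ⟨s, by grind⟩⟩
  rintro ⟨a, ha⟩
  simp only [Finset.ext_iff, mem_filter_univ, mem_singleton] at ha
  exact fun s' hs' => ((ha s').1 hs').trans ((ha s).1 hs).symm

theorem two_le_familyDegree_iff (hs : t ∈ H s) :
    2 ≤ familyDegree H t ↔ ∃ s' ≠ s, t ∈ H s' := by
  have hpos : 0 < familyDegree H t := card_pos.2 ⟨s, by simpa using hs⟩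
  have hone := familyDegree_eq_one_iff hs
  constructor
  · intro h2
    by_contra! hunique
    have := hone.2 fun s' hs' => by_contra fun hne => hunique s' hne hs'
    lia
  · rintro ⟨s', hne, hs'⟩
    have : familyDegree H t ≠ 1 := fun h1 => hne (hone.1 h1 s' hs')
    lia

theorem familyDegree_eq_one_or_two_le (hs : t ∈ H s) :
    familyDegree H t = 1 ∨ 2 ≤ familyDegree H t := by
  rw [familyDegree_eq_one_iff hs, two_le_familyDegree_iff hs]
  by_contra! h
  obtain ⟨⟨s', hs', hne⟩, h⟩ := h
  exact h s' hne hs'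

theorem eq_of_familyDegree_le_two {s₁ s₂ s₃ : α} (hd : familyDegree H t ≤ 2) (h₁ : t ∈ H s₁)
    (h₂ : t ∈ H s₂) (h₃ : t ∈ H s₃) (h₂₁ : s₂ ≠ s₁) (h₃₁ : s₃ ≠ s₁) : s₂ = s₃ := by
  by_contra h₂₃
  have : 2 < familyDegree H t := two_lt_card.2
    ⟨s₁, by simpa using h₁, s₂, by simpa using h₂, s₃, by simpa using h₃, h₂₁.symm, h₃₁.symm, h₂₃⟩
  lia

theorem familyDegree_congr (h : ∀ s, t ∈ H s ↔ t ∈ K s) : familyDegree H t = familyDegree K t := by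
  simp only [familyDegree, h]

theorem familyDegree_mono (h : H ≤ K) : familyDegree H t ≤ familyDegree K t :=
  card_le_card <| monotone_filter_right _ fun s _ hs => h s hs

theorem coveredPoints_mono (h : H ≤ K) : coveredPoints H ⊆ coveredPoints K :=
  biUnion_mono fun s _ => h s

theorem card_lt_card_coveredPoints (h : coveredPoints H ⊆ coveredPoints K)
    (ht : t ∉ coveredPoints H) (hts : t ∈ K s) : #(coveredPoints H) < #(coveredPoints K) :=
  card_lt_card ⟨h, fun hKH => ht (hKH (mem_coveredPoints_of_mem hts))⟩

/-- `H` is a trimming of `N` if it selects at most two points of each member of `N`, and only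
selects two points when one of them is selected elsewhere as well. A trimming that covers all points
yields the matching and the links: in each member all points but one are covered twice. -/
structure IsTrimming (N H : α → Finset β) : Prop where
  subset : ∀ s, H s ⊆ N s
  card_le : ∀ s, #(H s) ≤ 2
  exists_two_le : ∀ s, #(H s) = 2 → ∃ x ∈ H s, 2 ≤ familyDegree H x

/-- A trimming of `N` that covers as many points as possible. -/
abbrev IsOptimalTrimming (N : α → Finset β) : (α → Finset β) → Prop :=
  MaximalFor (IsTrimming N) fun H => #(coveredPoints H)

/-- The points of `H s` that may be exchanged for an arbitrary point of `N s` in a trimming. -/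
def replaceablePoints (H : α → Finset β) (s : α) : Finset β :=
  {x ∈ H s | ∀ y ∈ H s, y ≠ x → 2 ≤ familyDegree H y}

/-- `s` owns a point that no other member of the family contains. -/
def HasLeaf (H : α → Finset β) (s : α) : Prop := ∃ x ∈ H s, familyDegree H x = 1

/-- `m` is the middle of an exceptional configuration: `H m` has two points, each of which lies in
exactly one further member, and that member has a leaf. -/
structure IsMiddle (H : α → Finset β) (m : α) : Prop where
  card_eq : #(H m) = 2
  familyDegree_eq : ∀ x ∈ H m, familyDegree H x = 2
  hasLeaf : ∀ x ∈ H m, ∀ s ≠ m, x ∈ H s → HasLeaf H s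

/-- The local condition that keeps `H s` from making room for an uncovered point. -/
def IsSaturatedAt (H : α → Finset β) (s : α) : Prop := HasLeaf H s ∨ IsMiddle H s

theorem mem_replaceablePoints :
    x ∈ replaceablePoints H s ↔ x ∈ H s ∧ ∀ y ∈ H s, y ≠ x → 2 ≤ familyDegree H y := by
  simp [replaceablePoints]

theorem mem_of_mem_replaceablePoints (h : x ∈ replaceablePoints H s) : x ∈ H s :=
  (mem_replaceablePoints.1 h).1

theorem IsTrimming.two_le_familyDegree (h : IsTrimming N H) {y : β} (hx : x ∈ H s) (hy : y ∈ H s)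
    (hyx : y ≠ x) (hdx : familyDegree H x ≤ 1) : 2 ≤ familyDegree H y := by
  have hpair : {x, y} = H s := eq_of_subset_of_card_le (by grind) <|
    (h.card_le s).trans (card_pair hyx.symm).ge
  obtain ⟨w, hw, hdw⟩ := h.exists_two_le s (hpair ▸ card_pair hyx.symm)
  grind

theorem IsTrimming.mem_replaceablePoints_of_familyDegree_eq_one (h : IsTrimming N H) (hx : x ∈ H s)
    (hdx : familyDegree H x = 1) : x ∈ replaceablePoints H s :=
  mem_replaceablePoints.2
    ⟨hx, fun _ hy hyx => h.two_le_familyDegree hx hy hyx hdx.le⟩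

theorem IsTrimming.replaceablePoints_nonempty (h : IsTrimming N H) (hs : (H s).Nonempty) :
    (replaceablePoints H s).Nonempty := by
  by_cases hleaf : HasLeaf H s
  · obtain ⟨x, hx, hdx⟩ := hleaf
    exact ⟨x, h.mem_replaceablePoints_of_familyDegree_eq_one hx hdx⟩
  · obtain ⟨x, hx⟩ := hs
    refine ⟨x, mem_replaceablePoints.2 ⟨hx, fun y hy _ => ?_⟩⟩
    exact (familyDegree_eq_one_or_two_le hy).resolve_left fun hdy => hleaf ⟨y, hy, hdy⟩

theorem IsOptimalTrimming.not_isTrimming (h : IsOptimalTrimming N H)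
    (hK : #(coveredPoints H) < #(coveredPoints K)) : ¬ IsTrimming N K :=
  fun hKN => hK.not_ge (h.2 hKN hK.le)

section Update

variable [DecidableEq α]

theorem IsTrimming.update {A : Finset β} (h : IsTrimming N H) (hAN : A ⊆ N s) (hA : #A ≤ 2)
    (hpair : ∀ s', #(Function.update H s A s') = 2 →
      ∃ x ∈ Function.update H s A s', 2 ≤ familyDegree (Function.update H s A) x) :
    IsTrimming N (Function.update H s A) where
  subset s' := by
    rcases eq_or_ne s' s with rfl | hs'
    · simpa using hAN
    · simpa [hs'] using h.subset s'
  card_le s' := by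
    rcases eq_or_ne s' s with rfl | hs'
    · simpa using hA
    · simpa [hs'] using h.card_le s'
  exists_two_le := hpair

theorem IsTrimming.update_insert (h : IsTrimming N H) (hts : t ∈ N s) (hcard : #(H s) ≤ 1)
    (ht : t ∉ H s) (hdeg : t ∈ coveredPoints H ∨ ∀ x ∈ H s, 2 ≤ familyDegree H x) :
    IsTrimming N (Function.update H s (insert t (H s))) := by
  have hle : H ≤ Function.update H s (insert t (H s)) := le_update_self_iff.2 (subset_insert t _)
  refine h.update (insert_subset hts (h.subset s)) ((card_insert_le t _).trans (by lia))
    fun s' hs' => ?_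
  rcases eq_or_ne s' s with rfl | hne
  · rcases hdeg with htH | hdeg
    · obtain ⟨s'', ht''⟩ := mem_coveredPoints.1 htH
      have hne : s'' ≠ s' := fun e => ht (e ▸ ht'')
      have htK : t ∈ Function.update H s' (insert t (H s')) s' := by simp
      exact ⟨t, htK, (two_le_familyDegree_iff htK).2 ⟨s'', hne, hle s'' ht''⟩⟩
    · obtain ⟨x, hx⟩ : (H s').Nonempty := card_pos.1 <| by
        rw [Function.update_self, card_insert_of_notMem ht] at hs'
        lia
      exact ⟨x, hle s' hx, (hdeg x hx).trans (familyDegree_mono hle)⟩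
  · rw [Function.update_of_ne hne] at hs'
    obtain ⟨x, hx, hdx⟩ := h.exists_two_le s' hs'
    exact ⟨x, hle s' hx, hdx.trans (familyDegree_mono hle)⟩

theorem familyDegree_le_update_insert_erase_add_one (s : α) (t x : β) :
    familyDegree H x ≤ familyDegree (Function.update H s (insert t ((H s).erase x))) x + 1 := by
  refine (card_le_card fun s' hs' => ?_).trans (card_insert_le s _)
  rw [mem_insert, mem_filter_univ]
  exact or_iff_not_imp_left.2 fun hne => mem_update_insert_erase t (by simpa using hs') (.inl hne)

theorem familyDegree_le_update_insert_erase {y : β} (s : α) (t : β) (hyx : y ≠ x) :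
    familyDegree H y ≤ familyDegree (Function.update H s (insert t ((H s).erase x))) y :=
  card_le_card <| monotone_filter_right _ fun _ _ hs' => mem_update_insert_erase t hs' (.inr hyx)

theorem coveredPoints_subset_update_insert_erase (t : β) (hx : x ∈ H s)
    (hdx : 2 ≤ familyDegree H x) :
    coveredPoints H ⊆ coveredPoints (Function.update H s (insert t ((H s).erase x))) := by
  intro y hy
  obtain ⟨s', hs', hys'⟩ : ∃ s', (s' ≠ s ∨ y ≠ x) ∧ y ∈ H s' := by
    rcases eq_or_ne y x with rfl | hyx
    · obtain ⟨s', hs', hys'⟩ := (two_le_familyDegree_iff hx).1 hdx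
      exact ⟨s', .inl hs', hys'⟩
    · obtain ⟨s', hys'⟩ := mem_coveredPoints.1 hy
      exact ⟨s', .inr hyx, hys'⟩
  exact mem_coveredPoints_of_mem (mem_update_insert_erase t hys' hs')

end Update

theorem IsOptimalTrimming.card_eq_two (h : IsOptimalTrimming N H) (ht : t ∉ coveredPoints H)
    (hts : t ∈ N s) (hdeg : ∀ x ∈ H s, 2 ≤ familyDegree H x) : #(H s) = 2 := by
  classical
  by_contra hcard
  have hle : H ≤ Function.update H s (insert t (H s)) := le_update_self_iff.2 (subset_insert t _)
  have := h.prop.card_le s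
  exact h.not_isTrimming
    (card_lt_card_coveredPoints (coveredPoints_mono hle) ht (s := s) (by simp)) <|
    h.prop.update_insert hts (by lia) (fun hmem => ht (mem_coveredPoints_of_mem hmem)) (.inr hdeg)

/-- Replacing `x` by the uncovered point `t` in `H s` alone covers one more point, hence breaks the
pair condition at some other member of the family. -/
theorem IsOptimalTrimming.familyDegree_eq_two_and_exists_hasLeaf (h : IsOptimalTrimming N H)
    (ht : t ∉ coveredPoints H) (hts : t ∈ N s) (hdeg : ∀ y ∈ H s, 2 ≤ familyDegree H y)
    (hx : x ∈ H s) : familyDegree H x = 2 ∧ ∃ s' ≠ s, x ∈ H s' ∧ HasLeaf H s' := by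
  classical
  set K := Function.update H s (insert t ((H s).erase x)) with hK
  have hcard := h.card_eq_two ht hts hdeg
  obtain ⟨s', hs'card, hs'deg⟩ : ∃ s', #(K s') = 2 ∧ ∀ y ∈ K s', familyDegree K y ≤ 1 := by
    by_contra! hpair
    have hlt := card_lt_card_coveredPoints
      (coveredPoints_subset_update_insert_erase t hx (hdeg x hx)) ht (s := s) (by simp)
    refine h.not_isTrimming hlt <| h.prop.update ?_ ?_ fun s' hs' => hpair s' hs'
    · exact insert_subset hts ((erase_subset _ _).trans (h.prop.subset s))
    · exact (card_insert_le _ _).trans (by rw [card_erase_of_mem hx]; lia)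
  have hdeg_lt : ∀ y ∈ H s', y ≠ x → familyDegree H y < 2 := fun y hy hyx =>
    Nat.lt_succ_of_le <| (familyDegree_le_update_insert_erase s t hyx).trans
      (hs'deg y (mem_update_insert_erase t hy (.inr hyx)))
  have hne : s' ≠ s := by
    rintro rfl
    obtain ⟨y, hy, hyx⟩ := exists_mem_ne (by lia : 1 < #(H s')) x
    exact (hdeg_lt y hy hyx).not_ge (hdeg y hy)
  have hs'eq : K s' = H s' := Function.update_of_ne hne _ _
  rw [hs'eq] at hs'card hs'deg
  obtain ⟨w, hw, hdw⟩ := h.prop.exists_two_le s' hs'card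
  obtain rfl : w = x := by_contra fun hwx => (hdeg_lt w hw hwx).not_ge hdw
  obtain ⟨c, hc, hcw⟩ := exists_mem_ne (by lia : 1 < #(H s')) w
  refine ⟨hdw.antisymm' ?_, s', hne, hw, c, hc, ?_⟩
  · exact (familyDegree_le_update_insert_erase_add_one s t w).trans
      (Nat.succ_le_succ (hs'deg w hw))
  · exact (familyDegree_eq_one_or_two_le hc).resolve_right (hdeg_lt c hc hcw).not_ge

theorem IsOptimalTrimming.isSaturatedAt (h : IsOptimalTrimming N H) (ht : t ∉ coveredPoints H)
    (hts : t ∈ N s) : IsSaturatedAt H s := by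
  refine or_iff_not_imp_left.2 fun hleaf => ?_
  have hdeg : ∀ x ∈ H s, 2 ≤ familyDegree H x := fun x hx =>
    (familyDegree_eq_one_or_two_le hx).resolve_left fun hdx => hleaf ⟨x, hx, hdx⟩
  refine ⟨h.card_eq_two ht hts hdeg, fun x hx =>
    (h.familyDegree_eq_two_and_exists_hasLeaf ht hts hdeg hx).1, fun x hx s' hs' hxs' => ?_⟩
  obtain ⟨hdx, s'', hs'', hxs'', hleaf''⟩ :=
    h.familyDegree_eq_two_and_exists_hasLeaf ht hts hdeg hx
  rwa [eq_of_familyDegree_le_two hdx.le hx hxs' hxs'' hs' hs'']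

section AugmentingWalk

variable [DecidableEq α]

theorem familyDegree_exchangeFamily {y : β} (hyx : y ≠ x) (hyz : y ≠ z) :
    familyDegree (exchangeFamily H s₀ x z) y = familyDegree H y :=
  familyDegree_congr fun s => by simp [mem_exchangeFamily, hyx, hyz]

theorem coveredPoints_exchangeFamily :
    coveredPoints (exchangeFamily H s₀ x z) = insert z ((coveredPoints H).erase x) := by
  ext y
  simp only [mem_coveredPoints, mem_exchangeFamily, mem_insert, mem_erase, exists_or,
    exists_and_right, exists_and_left, exists_eq, and_true]
  tauto

theorem notMem_coveredPoints_exchangeFamily (hxz : x ≠ z) :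
    x ∉ coveredPoints (exchangeFamily H s₀ x z) := by
  simp [coveredPoints_exchangeFamily, hxz]

theorem IsTrimming.exchange (h : IsTrimming N H) (hx : x ∈ replaceablePoints H s₀)
    (hz : z ∉ coveredPoints H) (hzN : z ∈ N s₀) : IsTrimming N (exchangeFamily H s₀ x z) where
  subset s y hy := by
    rcases mem_exchangeFamily.1 hy with ⟨hy, -⟩ | ⟨rfl, rfl⟩
    exacts [h.subset s hy, hzN]
  card_le s := (card_exchangeFamily_le (mem_of_mem_replaceablePoints hx) s).trans (h.card_le s)
  exists_two_le s hs := by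
    obtain ⟨hxs₀, hxrep⟩ := mem_replaceablePoints.1 hx
    obtain ⟨y, hyH, hyx, hdy⟩ : ∃ y ∈ H s, y ≠ x ∧ 2 ≤ familyDegree H y := by
      rcases eq_or_ne s s₀ with rfl | hne
      · obtain ⟨y, hy, hyx⟩ := exists_mem_ne (hs.ge.trans (card_exchangeFamily_le hxs₀ s)) x
        exact ⟨y, hy, hyx, hxrep y hy hyx⟩
      · have heq := exchangeFamily_eq_of_card_eq_two hne (h.card_le s) hs
        obtain ⟨y, hy, hdy⟩ := h.exists_two_le s (heq ▸ hs)
        refine ⟨y, hy, ?_, hdy⟩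
        exact ((mem_exchangeFamily.1 (heq.ge hy)).resolve_right fun h => hne h.2).2
    have hyz : y ≠ z := ne_of_notMem_coveredPoints hz hyH
    refine ⟨y, mem_exchangeFamily.2 (.inl ⟨hyH, hyx⟩), ?_⟩
    exact hdy.trans_eq (familyDegree_exchangeFamily hyx hyz).symm

theorem IsOptimalTrimming.exchange (h : IsOptimalTrimming N H) (hx : x ∈ replaceablePoints H s₀)
    (hz : z ∉ coveredPoints H) (hzN : z ∈ N s₀) :
    IsOptimalTrimming N (exchangeFamily H s₀ x z) := by
  have hcard : #(coveredPoints (exchangeFamily H s₀ x z)) = #(coveredPoints H) := by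
    rw [coveredPoints_exchangeFamily, card_insert_of_notMem fun hmem => hz (mem_of_mem_erase hmem),
      card_erase_add_one (mem_coveredPoints_of_mem (mem_of_mem_replaceablePoints hx))]
  exact ⟨h.prop.exchange hx hz hzN, fun K hK _ => by
    have := le_total #(coveredPoints K) #(coveredPoints H)
    simp only [hcard]
    exact this.elim id (h.2 hK)⟩

theorem HasLeaf.of_exchangeFamily (hz : z ∉ coveredPoints H) (hs : s ≠ s₀)
    (h : HasLeaf (exchangeFamily H s₀ x z) s) : HasLeaf H s := by
  obtain ⟨y, hy, hdy⟩ := h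
  obtain ⟨hyH, hyx⟩ := (mem_exchangeFamily.1 hy).resolve_right fun h => hs h.2
  have hyz : y ≠ z := ne_of_notMem_coveredPoints hz hyH
  exact ⟨y, hyH, familyDegree_exchangeFamily (s₀ := s₀) hyx hyz ▸ hdy⟩

theorem IsOptimalTrimming.isSaturatedAt_of_exchangeFamily (h : IsOptimalTrimming N H)
    (hz : z ∉ coveredPoints H) (hzN : z ∈ N s₀) (hs : IsSaturatedAt (exchangeFamily H s₀ x z) s) :
    IsSaturatedAt H s := by
  have hs₀ := h.isSaturatedAt hz hzN
  rcases eq_or_ne s s₀ with rfl | hne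
  · exact hs₀
  rcases hs with hleaf | hmid
  · exact .inl (hleaf.of_exchangeFamily hz hne)
  refine or_iff_not_imp_left.2 fun hnleaf => ?_
  have heq := exchangeFamily_eq_of_card_eq_two hne (h.prop.card_le s) hmid.card_eq
  have hmem : ∀ y ∈ H s, y ∈ exchangeFamily H s₀ x z s ∧ y ≠ x ∧ y ≠ z := by
    intro y hy
    have hyE := heq.ge hy
    exact ⟨hyE, ((mem_exchangeFamily.1 hyE).resolve_right fun h => hne h.2).2,
      ne_of_notMem_coveredPoints hz hy⟩
  refine ⟨heq ▸ hmid.card_eq, fun y hy => ?_, fun y hy s' hs' hys' => ?_⟩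
  · obtain ⟨hyE, hyx, hyz⟩ := hmem y hy
    rw [← hmid.familyDegree_eq y hyE, familyDegree_exchangeFamily hyx hyz]
  · obtain ⟨hyE, hyx, -⟩ := hmem y hy
    rcases eq_or_ne s' s₀ with rfl | hne'
    · exact hs₀.resolve_right fun hmid₀ => hnleaf (hmid₀.hasLeaf y hys' s hne hy)
    · have hys'E : y ∈ exchangeFamily H s₀ x z s' := mem_exchangeFamily.2 (.inl ⟨hys', hyx⟩)
      exact (hmid.hasLeaf y hyE s' hs' hys'E).of_exchangeFamily hz hne'

theorem mem_replaceablePoints_exchangeFamily {y : β} (hx : x ∈ replaceablePoints H s₀)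
    (hz : z ∉ coveredPoints H) (hy : y ∈ replaceablePoints H s) (hy₀ : y ∉ replaceablePoints H s₀) :
    y ∈ replaceablePoints (exchangeFamily H s₀ x z) s := by
  have hs : s ≠ s₀ := fun e => hy₀ (e ▸ hy)
  have hyx : y ≠ x := fun e => hy₀ (e ▸ hx)
  obtain ⟨hyH, hyrep⟩ := mem_replaceablePoints.1 hy
  refine mem_replaceablePoints.2 ⟨mem_exchangeFamily.2 (.inl ⟨hyH, hyx⟩), fun b hb hby => ?_⟩
  obtain ⟨hbH, hbx⟩ := (mem_exchangeFamily.1 hb).resolve_right fun h => hs h.2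
  have hbz : b ≠ z := ne_of_notMem_coveredPoints hz hbH
  exact (hyrep b hbH hby).trans_eq (familyDegree_exchangeFamily hbx hbz).symm

/-- `Augmenting N H n t`: some alternating walk of `n` exchanges starts at `t` and ends next to a
member of `H` that is not saturated. -/
inductive Augmenting (N H : α → Finset β) : ℕ → β → Prop
  | zero {s : α} {t : β} : t ∈ N s → ¬ IsSaturatedAt H s → Augmenting N H 0 t
  | succ {n : ℕ} {s : α} {t x : β} : t ∈ N s → x ∈ replaceablePoints H s → Augmenting N H n x →
      Augmenting N H (n + 1) t

theorem Augmenting.exchange {n k : ℕ} (h : IsOptimalTrimming N H)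
    (hx : x ∈ replaceablePoints H s₀) (hz : z ∉ coveredPoints H) (hzN : z ∈ N s₀)
    (hmin : ∀ k ≤ n, ¬ Augmenting N H k z) (ht : Augmenting N H k t) (hk : k ≤ n) :
    Augmenting N (exchangeFamily H s₀ x z) k t := by
  induction ht with
  | zero hts hs => exact .zero hts fun hsat => hs (h.isSaturatedAt_of_exchangeFamily hz hzN hsat)
  | succ hts hy hyaug ih =>
    have hy₀ := fun hy₀ => hmin _ hk (.succ hzN hy₀ hyaug)
    exact .succ hts (mem_replaceablePoints_exchangeFamily hx hz hy hy₀) (ih (Nat.le_of_succ_le hk))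

end AugmentingWalk

theorem IsOptimalTrimming.not_augmenting {n : ℕ} (h : IsOptimalTrimming N H)
    (hz : z ∉ coveredPoints H) : ¬ Augmenting N H n z := by
  classical
  induction n using Nat.strong_induction_on generalizing H z with
  | _ n ih =>
    intro haug
    cases haug with
    | zero hzN hs => exact hs (h.isSaturatedAt hz hzN)
    | @succ n s₀ _ x hzN hx hxaug =>
      have hxz : x ≠ z := ne_of_notMem_coveredPoints hz (mem_of_mem_replaceablePoints hx)
      exact ih n n.lt_succ_self (h.exchange hx hz hzN) (notMem_coveredPoints_exchangeFamily hxz) <|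
        hxaug.exchange h hx hz hzN (fun k hk => ih k (Nat.lt_succ_of_le hk) h hz) le_rfl

section Counting

theorem HasLeaf.notMem_replaceablePoints (h : HasLeaf H s) (hdx : 2 ≤ familyDegree H x) :
    x ∉ replaceablePoints H s := by
  intro hx
  obtain ⟨y, hy, hdy⟩ := h
  have hyx : y ≠ x := by
    rintro rfl
    lia
  have := (mem_replaceablePoints.1 hx).2 y hy hyx
  lia

theorem IsSaturatedAt.eq_of_mem_replaceablePoints {s' : α} (h : IsSaturatedAt H s)
    (hx : x ∈ replaceablePoints H s) (hx' : x ∈ replaceablePoints H s') : s' = s := by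
  by_contra hne
  have hxs := mem_of_mem_replaceablePoints hx
  have hxs' := mem_of_mem_replaceablePoints hx'
  have hdx := (two_le_familyDegree_iff hxs).2 ⟨s', hne, hxs'⟩
  have hmid := h.resolve_left fun hleaf => hleaf.notMem_replaceablePoints hdx hx
  exact (hmid.hasLeaf x hxs s' hne hxs').notMem_replaceablePoints hdx hx'

theorem IsMiddle.replaceablePoints_eq (h : IsMiddle H s) : replaceablePoints H s = H s :=
  filter_true_of_mem fun _ _ y hy _ => (h.familyDegree_eq y hy).ge

theorem IsTrimming.sub_one_le_sum_replaceablePoints (h : IsTrimming N H) (hd : 3 ≤ d)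
    (hs : IsSaturatedAt H s) : d - 1 ≤ ∑ x ∈ replaceablePoints H s, (d - familyDegree H x) := by
  rcases hs with ⟨x, hx, hdx⟩ | hmid
  · rw [← hdx]
    exact single_le_sum_of_canonicallyOrdered (f := fun x => d - familyDegree H x)
      (h.mem_replaceablePoints_of_familyDegree_eq_one hx hdx)
  · rw [hmid.replaceablePoints_eq, sum_congr rfl fun x hx => by rw [hmid.familyDegree_eq x hx],
      sum_const, hmid.card_eq, smul_eq_mul]
    lia

theorem IsTrimming.card_mul_sub_one_le_sum (h : IsTrimming N H) (hd : 3 ≤ d) {Q : Finset α}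
    {R : Finset β} (hQ : ∀ s ∈ Q, IsSaturatedAt H s) (hR : ∀ s ∈ Q, replaceablePoints H s ⊆ R) :
    #Q * (d - 1) ≤ ∑ x ∈ R, (d - familyDegree H x) := by
  have hdisj : (Q : Set α).PairwiseDisjoint (replaceablePoints H) := fun s hs s' _ hne =>
    disjoint_left.2 fun x hx hx' => hne ((hQ s hs).eq_of_mem_replaceablePoints hx hx').symm
  calc #Q * (d - 1)
      ≤ ∑ s ∈ Q, ∑ x ∈ replaceablePoints H s, (d - familyDegree H x) :=
        card_nsmul_le_sum _ _ _ fun s hs => h.sub_one_le_sum_replaceablePoints hd (hQ s hs)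
    _ = ∑ x ∈ Q.biUnion (replaceablePoints H), (d - familyDegree H x) := (sum_biUnion hdisj).symm
    _ ≤ ∑ x ∈ R, (d - familyDegree H x) := sum_le_sum_of_subset (biUnion_subset.2 hR)

theorem familyDegree_sub_le_card {Q : Finset α} (hQ : ∀ s, t ∈ N s → s ∈ Q) :
    familyDegree N t - familyDegree H t ≤ #{s ∈ Q | t ∈ N s \ H s} := by
  classical
  rw [Nat.sub_le_iff_le_add']
  refine (card_le_card fun s hs => ?_).trans (card_union_le _ _)
  have hsN : t ∈ N s := by simpa using hs
  by_cases hsH : t ∈ H s <;> simp [hsN, hsH, hQ s hsN]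

theorem sum_sub_familyDegree_le_sum_card {Q : Finset α} {R : Finset β}
    (hN : ∀ t ∈ R, d ≤ familyDegree N t) (hQ : ∀ t ∈ R, ∀ s, t ∈ N s → s ∈ Q) :
    ∑ t ∈ R, (d - familyDegree H t) ≤ ∑ s ∈ Q, #{t ∈ R | t ∈ N s \ H s} := by
  refine (sum_le_sum fun t ht => ?_).trans_eq
    (sum_card_bipartiteAbove_eq_sum_card_bipartiteBelow fun t s => t ∈ N s \ H s)
  exact (Nat.sub_le_sub_right (hN t ht) _).trans (familyDegree_sub_le_card (hQ t ht))

theorem IsOptimalTrimming.of_le (h : IsOptimalTrimming N H) (hK : IsTrimming N K) (hHK : H ≤ K) :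
    IsOptimalTrimming N K := by
  have hcard := card_le_card (coveredPoints_mono hHK)
  exact ⟨hK, fun L hL hKL => (h.2 hL (hcard.trans hKL)).trans hcard⟩

theorem notMem_coveredPoints_of_card_le_one (h : Maximal (IsOptimalTrimming N) H)
    (hcard : #(H s) ≤ 1) (hts : t ∈ N s) (ht : t ∉ H s) : t ∉ coveredPoints H := by
  classical
  intro htH
  have hle : H ≤ Function.update H s (insert t (H s)) := le_update_self_iff.2 (subset_insert t _)
  have hopt := h.prop.of_le (h.prop.prop.update_insert hts hcard ht (.inl htH)) hle
  exact ht (h.le_of_ge hopt hle s (by simp))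

theorem coveredPoints_inter_sdiff_eq_empty (h : Maximal (IsOptimalTrimming N) H)
    (hcard : #(H s) ≤ 1) : coveredPoints H ∩ (N s \ H s) = ∅ := by
  refine eq_empty_of_forall_notMem fun t ht => ?_
  obtain ⟨htH, hts⟩ := mem_inter.1 ht
  obtain ⟨htN, hts⟩ := mem_sdiff.1 hts
  exact notMem_coveredPoints_of_card_le_one h hcard htN hts htH

theorem card_coveredPoints_inter_sdiff_le (h : Maximal (IsOptimalTrimming N) H)
    (hN : #(N s) ≤ d + 1) : #(coveredPoints H ∩ (N s \ H s)) ≤ d - 1 := by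
  rcases Nat.lt_or_ge 1 #(H s) with htwo | hone
  · have hsdiff := card_sdiff_of_subset (h.prop.prop.subset s)
    exact (card_le_card inter_subset_right).trans (by lia)
  · simp [coveredPoints_inter_sdiff_eq_empty h hone]

theorem card_coveredPoints_inter_sdiff_lt (h : Maximal (IsOptimalTrimming N) H)
    (hd : 2 ≤ d) (hN : #(N s) ≤ d + 1) (hz : z ∉ coveredPoints H) (hzN : z ∈ N s) :
    #(coveredPoints H ∩ (N s \ H s)) < d - 1 := by
  rcases Nat.lt_or_ge 1 #(H s) with htwo | hone
  · have hzs : z ∈ N s \ H s := mem_sdiff.2 ⟨hzN, fun hzs => hz (mem_coveredPoints_of_mem hzs)⟩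
    have hssub : coveredPoints H ∩ (N s \ H s) ⊂ N s \ H s :=
      ⟨inter_subset_right, fun hsub => hz (mem_inter.1 (hsub hzs)).1⟩
    have hsdiff := card_sdiff_of_subset (h.prop.prop.subset s)
    exact (card_lt_card hssub).trans_le (by lia)
  · rw [coveredPoints_inter_sdiff_eq_empty h hone, card_empty]
    lia

theorem mem_coveredPoints_of_maximal (h : Maximal (IsOptimalTrimming N) H) (hd : 3 ≤ d)
    (hNs : ∀ s, #(N s) ≤ d + 1) (hNt : ∀ t, d ≤ familyDegree N t) (z : β) :
    z ∈ coveredPoints H := by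
  classical
  by_contra hz
  let R : Finset β := {t ∈ coveredPoints H | ∀ n, ¬ Augmenting N H n t}
  let Q : Finset α := {s | ∃ t ∈ N s, ∀ n, ¬ Augmenting N H n t}
  have hQ : ∀ s ∈ Q, IsSaturatedAt H s := by
    intro s hs
    obtain ⟨t, hts, ht⟩ := (mem_filter_univ s).1 hs
    exact by_contra fun hsat => ht 0 (.zero hts hsat)
  have hQR : ∀ s ∈ Q, replaceablePoints H s ⊆ R := by
    intro s hs x hx
    obtain ⟨t, hts, ht⟩ := (mem_filter_univ s).1 hs
    exact mem_filter.2 ⟨mem_coveredPoints_of_mem (mem_of_mem_replaceablePoints hx),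
      fun n hxaug => ht (n + 1) (.succ hts hx hxaug)⟩
  have hRQ : ∀ t ∈ R, ∀ s, t ∈ N s → s ∈ Q := fun t ht s hts =>
    (mem_filter_univ s).2 ⟨t, hts, (mem_filter.1 ht).2⟩
  have hcard_le : ∀ s, #{t ∈ R | t ∈ N s \ H s} ≤ #(coveredPoints H ∩ (N s \ H s)) := fun s =>
    card_le_card fun t ht => by
      obtain ⟨htR, ht⟩ := mem_filter.1 ht
      exact mem_inter.2 ⟨(mem_filter.1 htR).1, ht⟩
  obtain ⟨s₀, hzs₀⟩ : ∃ s, z ∈ N s := by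
    obtain ⟨s, hs⟩ := card_pos.1 (show 0 < familyDegree N z by have := hNt z; lia)
    exact ⟨s, (mem_filter_univ s).1 hs⟩
  have hs₀ : s₀ ∈ Q := (mem_filter_univ s₀).2 ⟨z, hzs₀, fun n => h.prop.not_augmenting hz⟩
  have hlt : ∑ t ∈ R, (d - familyDegree H t) < #Q * (d - 1) := calc
    _ ≤ ∑ s ∈ Q, #{t ∈ R | t ∈ N s \ H s} :=
      sum_sub_familyDegree_le_sum_card (fun t _ => hNt t) hRQ
    _ < ∑ s ∈ Q, (d - 1) := sum_lt_sum
      (fun s _ => (hcard_le s).trans (card_coveredPoints_inter_sdiff_le h (hNs s)))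
      ⟨s₀, hs₀, (hcard_le s₀).trans_lt
        (card_coveredPoints_inter_sdiff_lt h (by lia) (hNs s₀) hz hzs₀)⟩
    _ = #Q * (d - 1) := sum_const_nat fun _ _ => rfl
  exact hlt.not_ge (h.prop.prop.card_mul_sub_one_le_sum hd hQ hQR)

end Counting

section Existence

variable [Finite β]

theorem exists_maximal_isOptimalTrimming (N : α → Finset β) :
    ∃ H, Maximal (IsOptimalTrimming N) H := by
  classical
  have hempty : IsTrimming N fun _ => ∅ := ⟨by simp, by simp, by simp⟩
  obtain ⟨H, hH⟩ := Set.Finite.exists_maximalFor (fun H => #(coveredPoints H))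
    {H | IsTrimming N H} (Set.toFinite _) ⟨_, hempty⟩
  exact Set.Finite.exists_maximal (s := {H | IsOptimalTrimming N H}) (Set.toFinite _) ⟨H, hH⟩

theorem exists_isTrimming_forall_mem_coveredPoints (hd : 3 ≤ d) (hNs : ∀ s, #(N s) ≤ d + 1)
    (hNt : ∀ t, d ≤ familyDegree N t) : ∃ H, IsTrimming N H ∧ ∀ t, t ∈ coveredPoints H := by
  obtain ⟨H, hH⟩ := exists_maximal_isOptimalTrimming N
  exact ⟨H, hH.prop.prop, mem_coveredPoints_of_maximal hH hd hNs hNt⟩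

end Existence

theorem IsTrimming.exists_representatives (h : IsTrimming N H) (hcov : ∀ t, t ∈ coveredPoints H) :
    ∃ X : Set β, (∃ f : X → α, f.Injective ∧ ∀ t, ↑t ∈ N (f t)) ∧
      ∃ p q : ↥Xᶜ → α, (∀ t, p t ≠ q t) ∧ (∀ t, ↑t ∈ N (p t)) ∧ (∀ t, ↑t ∈ N (q t)) ∧
        Pairwise (Disjoint on fun t => ({p t, q t} : Set α)) := by
  choose m hm using fun s : {s // (H s).Nonempty} => h.replaceablePoints_nonempty s.2
  have hmH : ∀ s, m s ∈ H s.1 := fun s => mem_of_mem_replaceablePoints (hm s)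
  have htwo : ∀ t : ↥(Set.range m)ᶜ, ∃ p q, p ≠ q ∧ ↑t ∈ H p ∧ ↑t ∈ H q := by
    rintro ⟨t, ht⟩
    obtain ⟨s, hts⟩ := mem_coveredPoints.1 (hcov t)
    have hdt := (mem_replaceablePoints.1 (hm ⟨s, t, hts⟩)).2 t hts fun e => ht ⟨_, e.symm⟩
    obtain ⟨s', hs', hts'⟩ := (two_le_familyDegree_iff hts).1 hdt
    exact ⟨s, s', hs'.symm, hts, hts'⟩
  choose p q hpq hp hq using htwo
  have heq : ∀ (t t' : ↥(Set.range m)ᶜ) s, ↑t ∈ H s → ↑t' ∈ H s → t = t' := by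
    rintro ⟨t, ht⟩ ⟨t', ht'⟩ s hts hts'
    by_contra hne
    have hms := hmH ⟨s, t, hts⟩
    refine (h.card_le s).not_gt <| two_lt_card.2 ⟨t, hts, t', hts', _, hms, ?_, ?_, ?_⟩
    exacts [fun e => hne (Subtype.ext e), fun e => ht ⟨_, e.symm⟩, fun e => ht' ⟨_, e.symm⟩]
  refine ⟨Set.range m, ⟨fun t => (t.2.choose : α), fun t t' htt' => ?_, fun t => ?_⟩,
    p, q, hpq, fun t => h.subset _ (hp t), fun t => h.subset _ (hq t), fun t t' hne => ?_⟩
  · rw [← Subtype.coe_inj, ← t.2.choose_spec, ← t'.2.choose_spec, Subtype.ext htt']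
  · have := h.subset _ (hmH t.2.choose)
    rwa [t.2.choose_spec] at this
  · have hmem : ∀ u, ∀ s ∈ ({p u, q u} : Set α), ↑u ∈ H s := by
      rintro u s (rfl | rfl)
      exacts [hp u, hq u]
    exact Set.disjoint_left.2 fun s hs hs' => hne (heq t t' s (hmem t s hs) (hmem t' s hs'))

end Trimming

section Graph

variable {V : Type*} {G : SimpleGraph V} {S T : Set V}

theorem exists_isMatching_of_injective {ι : Type*} (hST : Disjoint S T) {f g : ι → V}
    (hf : f.Injective) (hg : g.Injective) (hfS : ∀ i, f i ∈ S) (hgT : ∀ i, g i ∈ T)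
    (hadj : ∀ i, G.Adj (f i) (g i)) :
    ∃ M : G.Subgraph, M.IsMatching ∧ ∀ i, s(f i, g i) ∈ M.edgeSet := by
  have hne : ∀ i j, f i ≠ g j := fun i j => hST.ne_of_mem (hfS i) (hgT j)
  refine ⟨⨆ i, G.subgraphOfAdj (hadj i), .iSup (fun i => .subgraphOfAdj (hadj i)) ?_, fun i => ?_⟩
  · intro i j hij
    simp [hne, (hne _ _).symm, hf.ne hij.symm, hg.ne hij.symm]
  · rw [SimpleGraph.Subgraph.edgeSet_iSup]
    exact Set.mem_iUnion.2 ⟨i, by simp⟩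

/-- The path `u v w` of length two as a subgraph. -/
def linkSubgraph {u v w : V} (huv : G.Adj u v) (hvw : G.Adj v w) : G.Subgraph :=
  G.subgraphOfAdj huv ⊔ G.subgraphOfAdj hvw

theorem verts_linkSubgraph {u v w : V} (huv : G.Adj u v) (hvw : G.Adj v w) :
    (linkSubgraph huv hvw).verts = {u, v, w} := by
  simp [linkSubgraph, Set.insert_comm w, Set.pair_comm w]

theorem edgeSet_linkSubgraph {u v w : V} (huv : G.Adj u v) (hvw : G.Adj v w) :
    (linkSubgraph huv hvw).edgeSet = {s(u, v), s(v, w)} := by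
  simp [linkSubgraph, Set.pair_comm]

theorem exists_isLink_of_pairwise_disjoint {ι : Type*} (hST : Disjoint S T) {p q c : ι → V}
    (hpS : ∀ i, p i ∈ S) (hqS : ∀ i, q i ∈ S) (hcT : ∀ i, c i ∈ T) (hpq : ∀ i, p i ≠ q i)
    (hc : c.Injective) (hdisj : Pairwise (Disjoint on fun i => ({p i, q i} : Set V)))
    (hpc : ∀ i, G.Adj (p i) (c i)) (hqc : ∀ i, G.Adj (q i) (c i)) :
    ∃ F : Set G.Subgraph, (∀ P ∈ F, P.IsLink S) ∧
      F.PairwiseDisjoint SimpleGraph.Subgraph.verts ∧ ∀ i, ∃ P ∈ F, s(p i, c i) ∈ P.edgeSet := by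
  let P : ι → G.Subgraph := fun i => linkSubgraph (hpc i) (hqc i).symm
  have hverts : ∀ i, (P i).verts = {c i} ∪ {p i, q i} := fun i => by
    rw [verts_linkSubgraph, Set.insert_comm, Set.insert_eq]
  have hsub : ∀ i, ({p i, q i} : Set V) ⊆ S := fun i => Set.pair_subset (hpS i) (hqS i)
  have hPdisj : Pairwise (Disjoint on fun i => (P i).verts) := by
    intro i j hij
    have hcS : ∀ k l, Disjoint {c k} ({p l, q l} : Set V) := fun k l =>
      Set.disjoint_singleton_left.2 fun hmem => hST.notMem_of_mem_left (hsub l hmem) (hcT k)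
    simp only [Function.onFun, hverts, Set.disjoint_union_left, Set.disjoint_union_right]
    exact ⟨⟨by simpa using hc.ne hij, (hcS j i).symm⟩, hcS i j, hdisj hij⟩
  refine ⟨Set.range P, ?_, ?_, fun i => ⟨P i, ⟨i, rfl⟩, ?_⟩⟩
  · rintro _ ⟨i, rfl⟩
    exact ⟨p i, c i, q i, hpS i, hqS i, hpq i, verts_linkSubgraph _ _, edgeSet_linkSubgraph _ _⟩
  · rintro _ ⟨i, rfl⟩ _ ⟨j, rfl⟩ hij
    exact hPdisj (ne_of_apply_ne P hij)
  · rw [edgeSet_linkSubgraph]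
    exact Set.mem_insert _ _

end Graph

theorem mainTheorem4_general {V : Type*} [Fintype V] (G : SimpleGraph V) [DecidableRel G.Adj]
    (S T : Set V) (hG : G.IsBipartiteWith S T) {d : ℕ} (hd : 3 ≤ d)
    (hS : ∀ v ∈ S, G.degree v ≤ d + 1) :
    ∃ (M : G.Subgraph) (F : Set G.Subgraph),
      M.IsMatching ∧
      (∀ P ∈ F, P.IsLink S) ∧
      F.PairwiseDisjoint SimpleGraph.Subgraph.verts ∧
      ∀ v ∈ T, d ≤ G.degree v →
        ∃ e ∈ M.edgeSet ∪ ⋃ P ∈ F, P.edgeSet, v ∈ e := by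
  classical
  let N : V → Finset {v // v ∈ T ∧ d ≤ G.degree v} := fun s => (G.neighborFinset s).subtype _
  have hadj : ∀ {s t}, t ∈ N s → G.Adj s t := by simp [N]
  have hmemS : ∀ {s t}, t ∈ N s → s ∈ S := fun {_ t} ht =>
    hG.symm.mem_of_mem_adj t.2.1 (hadj ht).symm
  have hNs : ∀ s, #(N s) ≤ d + 1 := fun s => by
    rcases (N s).eq_empty_or_nonempty with hempty | ⟨t, ht⟩
    · simp [hempty]
    · exact (card_subtype _ _).trans_le ((card_filter_le _ _).trans (hS s (hmemS ht)))
  have hNt : ∀ t, d ≤ familyDegree N t := fun t => by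
    refine t.2.2.trans_eq (congrArg card ?_)
    ext s
    simp [N, G.adj_comm]
  obtain ⟨H, hH, hcov⟩ := exists_isTrimming_forall_mem_coveredPoints hd hNs hNt
  obtain ⟨X, ⟨f, hf, hfN⟩, p, q, hpq, hp, hq, hdisj⟩ := hH.exists_representatives hcov
  obtain ⟨M, hM, hMf⟩ := exists_isMatching_of_injective hG.disjoint hf
    (Subtype.val_injective.comp Subtype.val_injective) (fun t => hmemS (hfN t))
    (fun t => t.1.2.1) (fun t => hadj (hfN t))
  obtain ⟨F, hF, hFdisj, hFp⟩ := exists_isLink_of_pairwise_disjoint hG.disjoint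
    (fun t => hmemS (hp t)) (fun t => hmemS (hq t)) (fun t => t.1.2.1) hpq
    (Subtype.val_injective.comp Subtype.val_injective) hdisj (fun t => hadj (hp t))
    (fun t => hadj (hq t))
  refine ⟨M, F, hM, hF, hFdisj, fun v hvT hdv => ?_⟩
  by_cases hvX : ⟨v, hvT, hdv⟩ ∈ X
  · exact ⟨_, .inl (hMf ⟨_, hvX⟩), Sym2.mem_mk_right _ _⟩
  · obtain ⟨P, hPF, hP⟩ := hFp ⟨_, hvX⟩
    exact ⟨_, .inr (Set.mem_biUnion hPF hP), Sym2.mem_mk_right _ _⟩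

theorem mainTheorem4 {V : Type*} [Fintype V] (G : SimpleGraph V) [DecidableRel G.Adj]
    (S T : Set V) (hG : G.IsBipartiteWith S T)
    (hS : ∀ v ∈ S, G.degree v ≤ 4) (hT : ∀ v ∈ T, G.degree v ≤ 3) :
    ∃ (M : G.Subgraph) (F : Set G.Subgraph),
      M.IsMatching ∧
      (∀ P ∈ F, P.IsLink S) ∧
      F.PairwiseDisjoint SimpleGraph.Subgraph.verts ∧
      ∀ v ∈ T, G.degree v = 3 →
        ∃ e ∈ M.edgeSet ∪ ⋃ P ∈ F, P.edgeSet, v ∈ e := by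
  obtain ⟨M, F, hM, hF, hdisj, hcov⟩ := mainTheorem4_general G S T hG le_rfl hS
  exact ⟨M, F, hM, hF, hdisj, fun v hv hdeg => hcov v hv hdeg.ge⟩
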